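/- Let $G$ be a locally compact (Hausdorff) group and $K \subseteq G$ a compact open subgroup. Let $\mu$ be the left Haar measure on $G$ normalized so that $\mu(K) = 1$. For a measurable set $S \subseteq G$ write $S^n = \{s_1 \cdots s_n : s_1, \dots, s_n \in S\}$, and let $$\omega_G(S) := \limsup_{n \to \infty} \mu(S^n)^{1/n}$$ be the growth rate of $S$. The group $G$ is called Hermitian if every selfadjoint element of the Banach $*$-algebra $L^1(G)$ has real spectrum; here the product is $(f * h)(x) = \int_G f(y) h(y^{-1}x)\, d\mu(y)$, the involution is $f^*(x) = \Delta(x^{-1}) \overline{f(x^{-1})}$, and $\Delta$ is the modular function, determined by $\mu(Ax) = \Delta(x)\mu(A)$. Suppose that there exists $g \in G$ such that (i) $KgK = Kg^{-1}K$, (ii) $\mu(KgK) > 1$, (iii) $\omega_G(KgK) > \dfrac{\mu(KgK)}{2}$. Then $G$ is not Hermitian. -/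

import Mathlib

open MeasureTheory Measure Filter
open scoped NNReal ENNReal Pointwise

noncomputable section

namespace LCGroup

section Growth

variable {G : Type*} [Group G] [MeasurableSpace G]

/-- The growth rate `limsup μ(Sⁿ)^(1/n)` of a subset `S` of `G`, where
`Sⁿ = {s₁ ⋯ sₙ | sᵢ ∈ S}`; the value is taken in `[0, ∞]`. -/
def growthRate (μ : Measure G) (S : Set G) : ℝ≥0∞ :=
  limsup (fun n : ℕ => μ (S ^ n) ^ (1 / (n : ℝ))) atTop

end Growth

section GroupAlgebra

variable {G : Type*} [Group G] [TopologicalSpace G] [IsTopologicalGroup G]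
  [LocallyCompactSpace G]

/-- The modular function `Δ` of `G`, normalized by `μ(A g) = Δ(g) μ(A)` for a left Haar measure
`μ` (see `measure_mul_singleton`). Mathlib's `modularCharacter` is its inverse. -/
def modularFunction (g : G) : ℝ≥0 := (modularCharacter g)⁻¹

theorem measure_mul_singleton [MeasurableSpace G] [BorelSpace G] (μ : Measure G)
    [μ.IsHaarMeasure] [μ.Regular] (g : G) (A : Set G) :
    μ (A * {g}) = modularFunction g * μ A := by
  have hreg : (Measure.map (fun x => x * g⁻¹) μ).Regular :=
    Regular.map (Homeomorph.mulRight g⁻¹)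
  have h1 : Measure.map (fun x => x * g⁻¹) μ = modularCharacterFun g⁻¹ • μ := by
    rw [modularCharacterFun_eq_haarScalarFactor μ]
    exact isMulLeftInvariant_eq_smul_of_regular _ μ
  have h2 : Measure.map (fun x => x * g⁻¹) μ A = μ ((fun x => x * g⁻¹) ⁻¹' A) :=
    (Homeomorph.mulRight g⁻¹).toMeasurableEquiv.map_apply A
  have h3 : (fun x => x * g⁻¹) ⁻¹' A = A * {g} := by
    ext x
    simp
  have h4 : modularFunction g = modularCharacterFun g⁻¹ := (map_inv modularCharacter g).symm
  rw [← h3, ← h2, h1, h4]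
  rfl

variable [MeasurableSpace G]

/-- The convolution `(f ⋆ h)(x) = ∫ f(y) h(y⁻¹ x) dμ(y)`. For integrable `f` and `h` the integrand
is integrable for almost every `x`, and this is the product of `L¹(G)`. -/
def l1Conv (μ : Measure G) (f h : G → ℂ) : G → ℂ :=
  fun x => ∫ y, f y * h (y⁻¹ * x) ∂μ

/-- The involution `f*(x) = Δ(x⁻¹) conj (f(x⁻¹))` of `L¹(G)`. -/
def involution (f : G → ℂ) : G → ℂ :=
  fun x => ((modularFunction x⁻¹ : ℝ≥0) : ℂ) * star (f x⁻¹)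

/-- The spectrum of (the class of) an integrable function `f` in the Banach algebra `L¹(G)`, that
is, its spectrum in the unitization `ℂ 1 ⊕ L¹(G)`: the complex number `z` is in the spectrum unless
`z 1 - f` has a two-sided inverse `c 1 + h` with `c ∈ ℂ` and `h ∈ L¹(G)`. The two products
`(z 1 - f)(c 1 + h)` and `(c 1 + h)(z 1 - f)` are written out below. (If `L¹(G)` is itself unital,
then passing to the unitization can only add the real point `0` to the spectrum.) -/
def l1Spectrum (μ : Measure G) (f : G → ℂ) : Set ℂ :=
  {z | ¬ ∃ (c : ℂ) (h : G → ℂ), Integrable h μ ∧ z * c = 1 ∧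
    (∀ᵐ x ∂μ, z * h x - c * f x - l1Conv μ f h x = 0) ∧
    (∀ᵐ x ∂μ, z * h x - c * f x - l1Conv μ h f x = 0)}

/-- `G` is Hermitian, where `L¹(G)` is formed with respect to the (left) Haar measure `μ`: every
selfadjoint element of `L¹(G)` has real spectrum. Elements of `L¹(G)` are represented by
integrable functions, and equality in `L¹(G)` is equality almost everywhere. Rescaling `μ` gives
an isomorphic `*`-algebra, so this does not depend on the choice of `μ`. -/
def IsHermitian (μ : Measure G) : Prop :=
  ∀ f : G → ℂ, Integrable f μ → involution f =ᵐ[μ] f → ∀ z ∈ l1Spectrum μ f, z.im = 0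

end GroupAlgebra

end LCGroup

end

/-! Put `D = KgK` and `m = μ(D)`. Since `Δ = 1` on `D`, the indicator of `D` is selfadjoint, so a
Hermitian `G` would force its `L¹` spectrum to be real. Join `xK` to the `m` cosets inside `xD`.
Integrating over cosets turns an `L¹` resolvent of the indicator into a resolvent of the adjacency
operator `A` on `ℓ¹(G ⧸ K)` (`im_eq_zero_of_mem_spectrum_cosetAdjacency`), so `a = A/m` has spectrum
in `[-1, 1]`.

Chebyshev polynomials exploit this. If `w + w⁻¹ = 2t` with `t ∈ [-1, 1]`, then `|w| = 1`; hence the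
companion operator of `a` has spectral radius at most `1`, and by Gelfand's formula `‖Uₙ(a)‖` grows
subexponentially. On the sphere of radius `n` about `o`, only the leading term `(2a)ⁿ` of `Uₙ(a)`
contributes to `Uₙ(a) δ_o`, with value at least `(2/m)ⁿ` (`chebyshev_orbit_walkEnds`). So spheres
have at most `C cⁿ` points for each `c > m/2`. As `D ^ n` is covered by the cosets reached by walks
of length `n`, the growth rate of `D` is at most `m/2`, contradicting (iii). -/

noncomputable section

namespace LCGroup

/-! ### Spectrum and powers of the Chebyshev companion operator -/

section CompanionOperator

variable {E : Type*} [NormedAddCommGroup E] [NormedSpace ℂ E]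

/-- The operator `(u, v) ↦ (2 a u - v, u)` on `E × E`, whose powers generate the Chebyshev
polynomials of the second kind in `a`. -/
def chebyshevCompanion (a : E →L[ℂ] E) : (E × E) →L[ℂ] (E × E) :=
  (((2 : ℂ) • a).comp (ContinuousLinearMap.fst ℂ E E) - ContinuousLinearMap.snd ℂ E E).prod
    (ContinuousLinearMap.fst ℂ E E)

@[simp]
theorem chebyshevCompanion_apply (a : E →L[ℂ] E) (p : E × E) :
    chebyshevCompanion a p = ((2 : ℂ) • a p.1 - p.2, p.1) := rfl

theorem bijective_sub_of_notMem_spectrum [CompleteSpace E] {a : E →L[ℂ] E} {z : ℂ}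
    (hz : z ∉ spectrum ℂ a) : Function.Bijective fun x => z • x - a x := by
  have h := ContinuousLinearMap.isUnit_iff_bijective.1 (spectrum.notMem_iff.1 hz)
  convert! h using 1

theorem notMem_spectrum_of_bijective [CompleteSpace E] {a : E →L[ℂ] E} {z : ℂ}
    (h : Function.Bijective fun x => z • x - a x) : z ∉ spectrum ℂ a := by
  rw [spectrum.notMem_iff, ContinuousLinearMap.isUnit_iff_bijective]
  convert! h using 1

theorem norm_eq_one_of_sq_add_one {w : ℂ} {s : ℝ} (hs : |s| ≤ 1)
    (h : w ^ 2 + 1 = 2 * w * s) : ‖w‖ = 1 := by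
  have hre := congrArg Complex.re h
  have him := congrArg Complex.im h
  simp [pow_two] at hre him
  have h1 := abs_le.1 hs
  have key : w.re * w.re + w.im * w.im = 1 := by
    by_cases hq : w.im = 0
    · rw [hq] at hre ⊢
      have h2 : (w.re - s) ^ 2 = s ^ 2 - 1 := by linarith
      have h3 : s ^ 2 ≤ 1 := by nlinarith
      have h4 : w.re = s := by nlinarith [sq_nonneg (w.re - s)]
      nlinarith
    · have h2 : w.re = s := by
        apply mul_right_cancel₀ hq
        linarith
      rw [h2] at hre ⊢
      linarith
  rw [Complex.norm_def, Complex.normSq_apply, key, Real.sqrt_one]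

theorem norm_le_one_of_mem_spectrum_chebyshevCompanion [CompleteSpace E] {a : E →L[ℂ] E}
    (ha : ‖a‖ ≤ 1) (hreal : ∀ z ∈ spectrum ℂ a, z.im = 0) :
    ∀ w ∈ spectrum ℂ (chebyshevCompanion a), ‖w‖ ≤ 1 := by
  intro w hw
  by_contra! hw1
  have hw0 : w ≠ 0 := by
    rintro rfl
    simp at hw1
    linarith
  -- Substituting `u = w v` reduces inverting `w` minus the companion to inverting `w² + 1 - 2wa =
  -- 2w(t - a)`, where `t = (w² + 1) / (2w)`.
  have hns : (w ^ 2 + 1) / (2 * w) ∉ spectrum ℂ a := by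
    intro hmem
    have him := hreal _ hmem
    set t := (w ^ 2 + 1) / (2 * w) with ht
    have htn : ‖t‖ ≤ 1 := by
      have h1 := spectrum.norm_le_norm_mul_of_mem hmem
      -- Only an inequality, since `E` may be trivial.
      have h2 : ‖(1 : E →L[ℂ] E)‖ ≤ 1 := ContinuousLinearMap.norm_id_le
      nlinarith [norm_nonneg a, norm_nonneg (1 : E →L[ℂ] E)]
    have htr : ((t.re : ℝ) : ℂ) = t := Complex.ext (by simp) (by simp [him])
    have h3 : w ^ 2 + 1 = 2 * w * (t.re : ℝ) := by
      rw [htr, ht]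
      field_simp
    have := norm_eq_one_of_sq_add_one ((Complex.abs_re_le_norm t).trans htn) h3
    linarith
  have hb := bijective_sub_of_notMem_spectrum hns
  have h2w : (2 * w : ℂ) ≠ 0 := mul_ne_zero two_ne_zero hw0
  refine notMem_spectrum_of_bijective ?_ hw
  constructor
  · refine (injective_iff_map_eq_zero (AddMonoidHom.mk' (fun x => w • x - chebyshevCompanion a x)
      (fun x y => by simp only [smul_add, map_add]; abel))).2 ?_
    rintro ⟨u, v⟩ huv
    simp only [AddMonoidHom.mk'_apply, chebyshevCompanion_apply, Prod.smul_mk, Prod.mk_sub_mk,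
      Prod.mk_eq_zero, sub_eq_zero] at huv
    obtain ⟨h1, h2⟩ := huv
    have h3 : ((w ^ 2 + 1) / (2 * w)) • v - a v = ((w ^ 2 + 1) / (2 * w)) • 0 - a 0 := by
      have : (2 * w) • (((w ^ 2 + 1) / (2 * w)) • v - a v) = 0 := by
        rw [smul_sub, smul_smul, mul_div_cancel₀ _ h2w]
        rw [← h2, map_smul] at h1
        have h4 : (w * w) • v + v - (2 * w) • a v = 0 := by
          rw [smul_smul, smul_smul] at h1
          rw [h1]
          abel
        rw [← h4, add_smul, one_smul, pow_two]
      simpa [h2w] using this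
    have hv : v = 0 := hb.1 h3
    rw [hv, smul_zero] at h2
    rw [hv, ← h2]
    rfl
  · rintro ⟨p, q⟩
    -- The second coordinate forces `u = w v - q`; the first then becomes `2w(t - a) v = p + w q - 2
    -- a q`.
    obtain ⟨v, hv⟩ := hb.2 ((2 * w)⁻¹ • (p + w • q - (2 : ℂ) • a q))
    refine ⟨(w • v - q, v), ?_⟩
    have h1 : (w * w) • v + v - (2 * w) • a v = p + w • q - (2 : ℂ) • a q := by
      have := congrArg (fun x => (2 * w) • x) hv
      simp only [smul_sub, smul_smul, mul_div_cancel₀ _ h2w, mul_inv_cancel₀ h2w] at this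
      rwa [pow_two, add_smul, one_smul, one_smul, mul_inv_cancel_left₀ h2w] at this
    simp only [chebyshevCompanion_apply, Prod.smul_mk, Prod.mk_sub_mk, Prod.mk.injEq, map_sub,
      map_smul, smul_sub, smul_smul]
    refine ⟨?_, by abel⟩
    have h2 : (w * w) • v - w • q - ((2 * w) • a v - (2 : ℂ) • a q - v) =
      ((w * w) • v + v - (2 * w) • a v) - w • q + (2 : ℂ) • a q := by abel
    rw [h2, h1]
    abel

/-- Gelfand's formula gives the bound for large `n`; the finitely many remaining powers are absorbed
into `C`. -/
theorem exists_norm_pow_le_of_spectrum {A : Type*} [NormedRing A] [NormedAlgebra ℂ A]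
    [CompleteSpace A] {a : A} (ha : ∀ z ∈ spectrum ℂ a, ‖z‖ ≤ 1) {r : ℝ} (hr : 1 < r) :
    ∃ C : ℝ, 0 < C ∧ ∀ n : ℕ, ‖a ^ n‖ ≤ C * r ^ n := by
  have hρ : spectralRadius ℂ a ≤ 1 := by
    refine iSup₂_le fun z hz => ?_
    exact_mod_cast ha z hz
  have hlt : spectralRadius ℂ a < ENNReal.ofReal r := by
    refine hρ.trans_lt ?_
    rwa [ENNReal.one_lt_ofReal]
  have hev := (spectrum.pow_norm_pow_one_div_tendsto_nhds_spectralRadius a).eventually_lt_const hlt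
  obtain ⟨N, hN⟩ := eventually_atTop.1 hev
  have hr0 : 0 < r := by linarith
  refine ⟨1 + ∑ k ∈ Finset.range (N + 1), ‖a ^ k‖, by positivity, fun n => ?_⟩
  have hrn : 1 ≤ r ^ n := one_le_pow₀ hr.le
  have hs : 0 ≤ ∑ k ∈ Finset.range (N + 1), ‖a ^ k‖ := by positivity
  rcases le_or_gt n N with hn | hn
  · have : ‖a ^ n‖ ≤ ∑ k ∈ Finset.range (N + 1), ‖a ^ k‖ :=
      Finset.single_le_sum (f := fun k => ‖a ^ k‖) (fun _ _ => norm_nonneg _)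
        (Finset.mem_range.2 (by omega))
    nlinarith
  · have h1 := (ENNReal.ofReal_lt_ofReal_iff hr0).1 (hN n hn.le)
    have h2 : ‖a ^ n‖ ≤ r ^ n := by
      have hn0 : n ≠ 0 := by omega
      calc ‖a ^ n‖ = (‖a ^ n‖ ^ (1 / n : ℝ)) ^ n := by
            rw [one_div, Real.rpow_inv_natCast_pow (norm_nonneg _) hn0]
        _ ≤ r ^ n := by gcongr
    nlinarith

theorem exists_norm_chebyshevCompanion_pow_le [CompleteSpace E] {a : E →L[ℂ] E}
    (ha : ‖a‖ ≤ 1) (hreal : ∀ z ∈ spectrum ℂ a, z.im = 0) {r : ℝ} (hr : 1 < r) :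
    ∃ C : ℝ, 0 < C ∧ ∀ n : ℕ, ‖chebyshevCompanion a ^ n‖ ≤ C * r ^ n := by
  have h := norm_le_one_of_mem_spectrum_chebyshevCompanion ha hreal
  generalize chebyshevCompanion a = M at h ⊢
  exact exists_norm_pow_le_of_spectrum h hr

theorem im_eq_zero_of_mem_spectrum_inv_smul {A : Type*} [Ring A] [Algebra ℂ A] {a : A} {m : ℕ}
    (hm : 0 < m) (ha : ∀ z ∈ spectrum ℂ a, z.im = 0) :
    ∀ z ∈ spectrum ℂ ((m : ℂ)⁻¹ • a), z.im = 0 := by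
  intro z hz
  have hmC : (m : ℂ) ≠ 0 := Nat.cast_ne_zero.2 hm.ne'
  have h1 : (m : ℂ) * z ∈ spectrum ℂ a := by
    have := (spectrum.smul_mem_smul_iff (r := Units.mk0 (m : ℂ) hmC)).2 hz
    simpa [Units.smul_def, smul_smul, hmC] using this
  have h2 := ha _ h1
  rw [← Complex.ofReal_natCast, Complex.im_ofReal_mul] at h2
  exact (mul_eq_zero.1 h2).resolve_left (Nat.cast_ne_zero.2 hm.ne')

end CompanionOperator

/-! ### Operators on `ℓ¹(X)` given by their values on the basis -/

section SummableFunctions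

variable {X : Type*} {F : Type*} [NormedAddCommGroup F] [NormedSpace ℂ F]

theorem hasSum_norm_l1 (φ : lp (fun _ : X => ℂ) 1) : HasSum (fun x => ‖φ x‖) ‖φ‖ := by
  simpa using lp.hasSum_norm (by simp) φ

theorem sum_norm_le_norm_l1 (φ : lp (fun _ : X => ℂ) 1) (s : Finset X) :
    ∑ x ∈ s, ‖φ x‖ ≤ ‖φ‖ :=
  sum_le_hasSum s (fun _ _ => norm_nonneg _) (hasSum_norm_l1 φ)

theorem norm_smul_le_of_bounded {w : X → F} {C : ℝ} (hw : ∀ x, ‖w x‖ ≤ C)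
    (φ : lp (fun _ : X => ℂ) 1) (x : X) : ‖φ x • w x‖ ≤ ‖φ x‖ * C := by
  rw [norm_smul]
  exact mul_le_mul_of_nonneg_left (hw x) (norm_nonneg _)

theorem summable_smul_of_bounded [CompleteSpace F] {w : X → F} {C : ℝ} (hw : ∀ x, ‖w x‖ ≤ C)
    (φ : lp (fun _ : X => ℂ) 1) : Summable fun x => φ x • w x :=
  .of_norm_bounded ((hasSum_norm_l1 φ).summable.mul_right C) (norm_smul_le_of_bounded hw φ)

/-- The operator on `ℓ¹(X)` with prescribed bounded values on the standard basis. -/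
def l1Lift [CompleteSpace F] (w : X → F) (C : ℝ) (hw : ∀ x, ‖w x‖ ≤ C) :
    lp (fun _ : X => ℂ) 1 →L[ℂ] F :=
  LinearMap.mkContinuous
    { toFun := fun φ => ∑' x, φ x • w x
      map_add' := fun φ ψ => by
        rw [← (summable_smul_of_bounded hw φ).tsum_add (summable_smul_of_bounded hw ψ)]
        simp [add_smul]
      map_smul' := fun c φ => by
        rw [RingHom.id_apply, ← (summable_smul_of_bounded hw φ).tsum_const_smul]
        simp [mul_smul] } C fun φ => by
    rw [mul_comm]
    exact tsum_of_norm_bounded ((hasSum_norm_l1 φ).mul_right C) (norm_smul_le_of_bounded hw φ)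

theorem l1Lift_apply [CompleteSpace F] (w : X → F) (C : ℝ) (hw : ∀ x, ‖w x‖ ≤ C)
    (φ : lp (fun _ : X => ℂ) 1) : l1Lift w C hw φ = ∑' x, φ x • w x := rfl

theorem norm_l1Lift_le [CompleteSpace F] (w : X → F) (C : ℝ) (hC : 0 ≤ C) (hw : ∀ x, ‖w x‖ ≤ C) :
    ‖l1Lift w C hw‖ ≤ C :=
  LinearMap.mkContinuous_norm_le _ hC _

@[simp]
theorem l1Lift_single [DecidableEq X] [CompleteSpace F] (w : X → F) (C : ℝ) (hw : ∀ x, ‖w x‖ ≤ C)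
    (x : X) :
    l1Lift w C hw (lp.single 1 x 1) = w x := by
  rw [l1Lift_apply, tsum_eq_single x]
  · simp
  · intro y hy
    simp [hy]

theorem l1_ext [DecidableEq X] {S T : lp (fun _ : X => ℂ) 1 →L[ℂ] F}
    (h : ∀ x, S (lp.single 1 x 1) = T (lp.single 1 x 1)) : S = T := by
  refine lp.ext_continuousLinearMap ENNReal.one_ne_top fun x => ?_
  ext
  exact h x

/-- The bilinear pairing `∑ u(x) φ(x)` of summable functions. -/
def l1Pairing (u : lp (fun _ : X => ℂ) 1) : lp (fun _ : X => ℂ) 1 →L[ℂ] ℂ :=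
  l1Lift (fun x => u x) ‖u‖ fun x => lp.norm_apply_le_norm one_ne_zero u x

theorem l1Pairing_apply (u φ : lp (fun _ : X => ℂ) 1) : l1Pairing u φ = ∑' x, φ x * u x := rfl

theorem l1Pairing_comm (u φ : lp (fun _ : X => ℂ) 1) : l1Pairing u φ = l1Pairing φ u := by
  simp only [l1Pairing_apply, mul_comm]

end SummableFunctions

/-! ### Adjacency operators on `ℓ¹` and sphere growth -/

section RegularGraph

variable {X : Type*} [DecidableEq X]

/-- The adjacency operator on `ℓ¹(X)` of a graph whose vertices have at most `m` neighbours. -/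
def adjacency (N : X → Finset X) (m : ℕ) (hN : ∀ x, (N x).card ≤ m) :
    lp (fun _ : X => ℂ) 1 →L[ℂ] lp (fun _ : X => ℂ) 1 :=
  l1Lift (fun x => ∑ y ∈ N x, lp.single 1 y 1) m fun x => by
    refine (norm_sum_le _ _).trans ?_
    simpa using hN x

variable {N : X → Finset X} {m : ℕ} (hN : ∀ x, (N x).card ≤ m)

theorem adjacency_single (x : X) :
    adjacency N m hN (lp.single 1 x 1) = ∑ y ∈ N x, lp.single 1 y 1 := l1Lift_single _ _ _ _

theorem norm_adjacency_le : ‖adjacency N m hN‖ ≤ m :=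
  norm_l1Lift_le _ _ (Nat.cast_nonneg m) _

variable (hsymm : ∀ x y, y ∈ N x → x ∈ N y)
include hsymm

theorem adjacency_apply (φ : lp (fun _ : X => ℂ) 1) (y : X) :
    adjacency N m hN φ y = ∑ x ∈ N y, φ x := by
  have : (lp.evalCLM ℂ (fun _ : X => ℂ) 1 y).comp (adjacency N m hN) =
      ∑ x ∈ N y, lp.evalCLM ℂ (fun _ : X => ℂ) 1 x := by
    refine l1_ext fun x => ?_
    rw [ContinuousLinearMap.comp_apply, adjacency_single, _root_.sum_apply]
    change (∑ z ∈ N x, (lp.single 1 z 1 : lp (fun _ : X => ℂ) 1)) y =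
      ∑ z ∈ N y, (lp.single 1 x 1 : lp (fun _ : X => ℂ) 1) z
    simp only [lp.coeFn_sum, Finset.sum_apply, lp.single_apply, Pi.single_apply,
      Finset.sum_ite_eq, Finset.sum_ite_eq']
    exact if_congr ⟨hsymm x y, hsymm y x⟩ rfl rfl
  have h := congrArg (fun S => S φ) this
  simp only [_root_.sum_apply] at h
  exact h

theorem l1Pairing_adjacency (u φ : lp (fun _ : X => ℂ) 1) :
    l1Pairing u (adjacency N m hN φ) = l1Pairing (adjacency N m hN u) φ := by
  have : (l1Pairing u).comp (adjacency N m hN) = l1Pairing (adjacency N m hN u) := by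
    refine l1_ext fun x => ?_
    rw [ContinuousLinearMap.comp_apply, adjacency_single, _root_.map_sum]
    simp only [l1Pairing, l1Lift_single]
    rw [adjacency_apply hN hsymm]
  exact congrArg (fun S => S φ) this

/-- Uniformly bounded columns `v x` assemble into a right inverse of `z - A`. Injectivity comes for
free, because `A` is its own transpose for the bilinear pairing: pairing `(z - A) φ` with `v x`
returns `φ x`. -/
theorem notMem_spectrum_adjacency {z : ℂ} {C : ℝ}
    (hz : ∀ x, ∃ v : lp (fun _ : X => ℂ) 1, ‖v‖ ≤ C ∧
      z • v - adjacency N m hN v = lp.single 1 x 1) :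
    z ∉ spectrum ℂ (adjacency N m hN) := by
  choose v hvC hv using hz
  refine notMem_spectrum_of_bijective ⟨?_, fun φ => ⟨l1Lift v C hvC φ, ?_⟩⟩
  · refine (injective_iff_map_eq_zero (AddMonoidHom.mk' (fun x => z • x - adjacency N m hN x)
      (fun x y => by simp only [smul_add, map_add]; abel))).2 fun φ hφ => ?_
    rw [AddMonoidHom.mk'_apply] at hφ
    ext x
    have h1 : l1Pairing (v x) (z • φ - adjacency N m hN φ) = φ x := by
      rw [map_sub, map_smul, l1Pairing_adjacency hN hsymm, l1Pairing_comm, l1Pairing_comm _ φ,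
        ← map_smul, ← map_sub, hv x]
      simp [l1Pairing]
    rw [← h1, hφ, map_zero]
    rfl
  · have : z • l1Lift v C hvC - (adjacency N m hN).comp (l1Lift v C hvC) =
        ContinuousLinearMap.id ℂ _ := by
      refine l1_ext fun x => ?_
      simpa using hv x
    exact congrArg (fun S => S φ) this

omit hsymm in
/-- The endpoints of the walks of length `n` from `o`. -/
def walkEnds (N : X → Finset X) (o : X) : ℕ → Finset X
  | 0 => {o}
  | n + 1 => (walkEnds N o n).biUnion N

theorem neighbor_mem_walkEnds {o x y : X} {n : ℕ} (hy : y ∈ N x) (h : y ∈ walkEnds N o n) :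
    x ∈ walkEnds N o (n + 1) :=
  Finset.mem_biUnion.2 ⟨y, h, hsymm x y hy⟩

/-- Here `p = (Uₙ(a) δ_o, Uₙ₋₁(a) δ_o)`, supported in the balls of radius `n` and `n - 1`. Outside
the smaller ball the subtracted term of the recursion vanishes, so no cancellation occurs, and each
step along a shortest walk contributes a factor `2/m`. -/
theorem chebyshev_orbit_walkEnds (o : X) (n : ℕ) :
    let p := (chebyshevCompanion ((m : ℂ)⁻¹ • adjacency N m hN) ^ n) (lp.single 1 o 1, 0)
    (∀ x, (∀ k ≤ n, x ∉ walkEnds N o k) → p.1 x = 0) ∧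
    (∀ x, (∀ k < n, x ∉ walkEnds N o k) → p.2 x = 0) ∧
    (∀ x, (∀ k < n, x ∉ walkEnds N o k) → ∃ r : ℝ, 0 ≤ r ∧ p.1 x = r ∧
      (x ∈ walkEnds N o n → (2 / m : ℝ) ^ n ≤ r)) := by
  induction n with
  | zero =>
    simp only [pow_zero, one_apply_eq_self]
    refine ⟨fun x hx => ?_, fun x _ => rfl, fun x _ => ?_⟩
    · have := hx 0 le_rfl
      simp only [walkEnds, Finset.mem_singleton] at this
      exact lp.single_apply_ne 1 o _ this
    · by_cases hx : x = o
      · subst hx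
        exact ⟨1, zero_le_one, by simp, fun _ => le_rfl⟩
      · exact ⟨0, le_rfl, by simp [hx], fun h => absurd (Finset.mem_singleton.1 h) hx⟩
  | succ n ih =>
    rw [pow_succ']
    simp only [mul_apply_eq_comp, chebyshevCompanion_apply]
    set p := (chebyshevCompanion ((m : ℂ)⁻¹ • adjacency N m hN) ^ n) (lp.single 1 o 1, 0)
    obtain ⟨ih1, ih2, ih3⟩ := ih
    have hval : ∀ x, ((2 : ℂ) • ((m : ℂ)⁻¹ • adjacency N m hN) p.1 - p.2) x =
        2 / m * ∑ y ∈ N x, p.1 y - p.2 x := fun x => by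
      rw [← adjacency_apply hN hsymm p.1 x, div_eq_mul_inv, mul_assoc]
      rfl
    refine ⟨fun x hx => ?_, fun x hx => ih1 x fun k hk => hx k (by omega), fun x hx => ?_⟩
    · rw [hval, ih2 x fun k hk => hx k (by omega), Finset.sum_eq_zero, mul_zero, sub_zero]
      exact fun y hy => ih1 y fun k hk hmem =>
        hx (k + 1) (by omega) (neighbor_mem_walkEnds hsymm hy hmem)
    · have hy : ∀ y ∈ N x, ∀ k < n, y ∉ walkEnds N o k := fun y hy k hk hmem =>
        hx (k + 1) (by omega) (neighbor_mem_walkEnds hsymm hy hmem)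
      have hr : ∀ y ∈ N x, ∃ r : ℝ, 0 ≤ r ∧ p.1 y = r ∧
          (y ∈ walkEnds N o n → (2 / m : ℝ) ^ n ≤ r) := fun y h => ih3 y (hy y h)
      choose! r hr0 hpr hrn using hr
      refine ⟨2 / m * ∑ y ∈ N x, r y, ?_, ?_, fun hmem => ?_⟩
      · exact mul_nonneg (by positivity) (Finset.sum_nonneg hr0)
      · rw [hval, ih2 x fun k hk => hx k (by omega), sub_zero, Finset.sum_congr rfl hpr]
        push_cast
        rfl
      · obtain ⟨y, hyn, hxy⟩ := Finset.mem_biUnion.1 hmem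
        have hyx := hsymm y x hxy
        rw [pow_succ']
        refine mul_le_mul_of_nonneg_left ?_ (by positivity)
        exact (hrn y hyx hyn).trans (Finset.single_le_sum hr0 hyx)

theorem card_sphere_le (o : X) {C c : ℝ} (hm : 0 < m) (n : ℕ)
    (hpow : ‖chebyshevCompanion ((m : ℂ)⁻¹ • adjacency N m hN) ^ n‖ ≤ C * (2 / m * c) ^ n) :
    (((walkEnds N o n).filter fun x => ∀ k < n, x ∉ walkEnds N o k).card : ℝ) ≤ C * c ^ n := by
  have hm0 : (0 : ℝ) < m := Nat.cast_pos.2 hm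
  obtain ⟨-, -, h3⟩ := chebyshev_orbit_walkEnds hN hsymm o n
  generalize hp : (chebyshevCompanion ((m : ℂ)⁻¹ • adjacency N m hN) ^ n)
    (lp.single 1 o 1, 0) = p at h3
  have h1 : ∀ x ∈ (walkEnds N o n).filter fun x => ∀ k < n, x ∉ walkEnds N o k,
      (2 / m : ℝ) ^ n ≤ ‖p.1 x‖ := by
    intro x hx
    obtain ⟨hxn, hxk⟩ := Finset.mem_filter.1 hx
    obtain ⟨r, hr0, hpr, hrn⟩ := h3 x hxk
    rw [hpr, Complex.norm_real, Real.norm_of_nonneg hr0]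
    exact hrn hxn
  have h2 : ‖p.1‖ ≤ C * (2 / m * c) ^ n := by
    refine (norm_fst_le p).trans ?_
    rw [← hp]
    refine (ContinuousLinearMap.le_opNorm _ _).trans ?_
    have : ‖((lp.single 1 o 1, 0) : lp (fun _ : X => ℂ) 1 × lp (fun _ : X => ℂ) 1)‖ = 1 := by
      simp [Prod.norm_def]
    rw [this, mul_one]
    exact hpow
  have h4 := (Finset.card_nsmul_le_sum _ _ _ h1).trans ((sum_norm_le_norm_l1 p.1 _).trans h2)
  rw [nsmul_eq_mul, mul_pow, ← mul_assoc, mul_right_comm] at h4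
  exact le_of_mul_le_mul_right h4 (by positivity)

theorem card_walkEnds_le (hm : 0 < m) (hreal : ∀ z ∈ spectrum ℂ (adjacency N m hN), z.im = 0)
    (o : X) {c : ℝ} (hc1 : 1 ≤ c) (hmc : (m : ℝ) / 2 < c) :
    ∃ C : ℝ, 0 < C ∧ ∀ n : ℕ, ((walkEnds N o n).card : ℝ) ≤ C * (n + 1) * c ^ n := by
  have hm0 : (0 : ℝ) < m := Nat.cast_pos.2 hm
  have hanorm : ‖(m : ℂ)⁻¹ • adjacency N m hN‖ ≤ 1 := by
    rw [norm_smul, norm_inv, Complex.norm_natCast, inv_mul_le_iff₀ hm0, mul_one]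
    exact norm_adjacency_le hN
  have hareal := im_eq_zero_of_mem_spectrum_inv_smul hm hreal
  have hr : 1 < 2 / m * c := by
    rw [div_mul_eq_mul_div, one_lt_div hm0]
    linarith
  obtain ⟨C, hC, hpow⟩ := exists_norm_chebyshevCompanion_pow_le hanorm hareal hr
  let B : ℕ → Finset X := fun n => (walkEnds N o n).filter fun x => ∀ k < n, x ∉ walkEnds N o k
  have hB : ∀ n, ((B n).card : ℝ) ≤ C * c ^ n := fun n => card_sphere_le hN hsymm o hm n (hpow n)
  clear hpow hreal hareal hanorm
  refine ⟨C, hC, fun n => ?_⟩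
  -- Each endpoint lies on the sphere indexed by the length of a shortest walk to it.
  have hsub : walkEnds N o n ⊆ (Finset.range (n + 1)).biUnion B := by
    intro x hx
    have hex : ∃ k, x ∈ walkEnds N o k := ⟨n, hx⟩
    refine Finset.mem_biUnion.2 ⟨Nat.find hex, ?_, ?_⟩
    · exact Finset.mem_range.2 (Nat.lt_succ_of_le (Nat.find_min' hex hx))
    · exact Finset.mem_filter.2 ⟨Nat.find_spec hex, fun k hk => Nat.find_min hex hk⟩
  calc ((walkEnds N o n).card : ℝ) ≤ ∑ k ∈ Finset.range (n + 1), ((B k).card : ℝ) := by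
        exact_mod_cast (Finset.card_le_card hsub).trans Finset.card_biUnion_le
    _ ≤ ∑ k ∈ Finset.range (n + 1), C * c ^ n := by
        -- Replacing `c ^ k` by `c ^ n` is where `1 ≤ c` enters.
        refine Finset.sum_le_sum fun k hk => (hB k).trans ?_
        have : k ≤ n := by simpa [Nat.lt_succ_iff] using hk
        gcongr
    _ = C * (n + 1) * c ^ n := by
        rw [Finset.sum_const, Finset.card_range, nsmul_eq_mul]
        push_cast
        ring

end RegularGraph

end LCGroup

end

noncomputable section

namespace LCGroup

/-! ### Growth rate from an exponential bound -/

section Limsup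

theorem limsup_rpow_one_div_le {s : ℕ → ℝ≥0∞} {C c d : ℝ} (hc : 0 < c) (hcd : c < d)
    (hs : ∀ n : ℕ, s n ≤ ENNReal.ofReal (C * (n + 1) * c ^ n)) :
    limsup (fun n : ℕ => s n ^ (1 / (n : ℝ))) atTop ≤ ENNReal.ofReal d := by
  have hd : 0 < d := hc.trans hcd
  have hq0 : 0 ≤ c / d := by positivity
  have hq1 : c / d < 1 := (div_lt_one hd).2 hcd
  have hlim : Tendsto (fun n : ℕ => C * (n * (c / d) ^ n + (c / d) ^ n)) atTop (nhds 0) := by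
    simpa using ((tendsto_self_mul_const_pow_of_lt_one hq0 hq1).add
      (tendsto_pow_atTop_nhds_zero_of_lt_one hq0 hq1)).const_mul C
  refine limsup_le_of_le (by isBoundedDefault) ?_
  filter_upwards [hlim.eventually_lt_const one_pos, eventually_gt_atTop 0] with n hn hn0
  have h1 : C * (n + 1) * c ^ n ≤ d ^ n := by
    have hdn : 0 < d ^ n := by positivity
    have h2 : C * (n * (c / d) ^ n + (c / d) ^ n) = C * (n + 1) * c ^ n / d ^ n := by
      rw [div_pow]
      ring
    rw [h2, div_lt_one hdn] at hn
    exact hn.le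
  calc s n ^ (1 / (n : ℝ)) ≤ (ENNReal.ofReal d ^ n) ^ (1 / (n : ℝ)) := by
        refine ENNReal.rpow_le_rpow ?_ (by positivity)
        rw [← ENNReal.ofReal_pow hd.le]
        exact (hs n).trans (ENNReal.ofReal_le_ofReal h1)
    _ = ENNReal.ofReal d := by
        rw [one_div, ENNReal.pow_rpow_inv_natCast hn0.ne']

end Limsup

/-! ### Integration over left cosets of `K` -/

section Cosets

variable {G : Type*} [Group G]

/-- The left coset of `K` in `G` given by a point of `G ⧸ K`. -/
def fiber {K : Subgroup G} (y : G ⧸ K) : Set G := {t | (t : G ⧸ K) = y}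

@[simp]
theorem mem_fiber {K : Subgroup G} {y : G ⧸ K} {t : G} : t ∈ fiber y ↔ (t : G ⧸ K) = y := Iff.rfl

theorem pairwise_disjoint_fiber {K : Subgroup G} :
    Pairwise (Function.onFun Disjoint (fiber : G ⧸ K → Set G)) := fun _ _ hxy =>
  Set.disjoint_left.2 fun _ hx hy => hxy (hx.symm.trans hy)

theorem fiber_mk_eq_preimage (K : Subgroup G) (a : G) :
    fiber (a : G ⧸ K) = (fun t => a⁻¹ * t) ⁻¹' (K : Set G) := by
  ext t
  rw [mem_fiber, eq_comm, QuotientGroup.eq]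
  rfl

variable [TopologicalSpace G] [IsTopologicalGroup G] [MeasurableSpace G] [BorelSpace G]
  {μ : Measure G} {K : Subgroup G}

theorem measure_fiber [μ.IsHaarMeasure] (hμK : μ (K : Set G) = 1) (y : G ⧸ K) :
    μ (fiber y) = 1 := by
  obtain ⟨a, rfl⟩ := QuotientGroup.mk_surjective y
  rw [fiber_mk_eq_preimage, measure_preimage_mul, hμK]

variable (hKo : IsOpen (K : Set G))
include hKo

theorem measurableSet_fiber (y : G ⧸ K) : MeasurableSet (fiber y) := by
  obtain ⟨a, rfl⟩ := QuotientGroup.mk_surjective y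
  rw [fiber_mk_eq_preimage]
  exact (hKo.preimage (continuous_const_mul a⁻¹)).measurableSet

theorem measure_biUnion_fiber [μ.IsHaarMeasure] (hμK : μ (K : Set G) = 1) (s : Finset (G ⧸ K)) :
    μ (⋃ y ∈ s, fiber y) = s.card := by
  rw [measure_biUnion_finset (fun _ _ _ _ h => pairwise_disjoint_fiber h)
    fun y _ => measurableSet_fiber hKo y]
  simp [measure_fiber hμK]

theorem setIntegral_biUnion_fiber (s : Finset (G ⧸ K)) {h : G → ℂ} (hh : Integrable h μ) :
    ∫ t in ⋃ y ∈ s, fiber y, h t ∂μ = ∑ y ∈ s, ∫ t in fiber y, h t ∂μ :=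
  integral_biUnion_finset s (fun y _ => measurableSet_fiber hKo y)
    (fun _ _ _ _ h => pairwise_disjoint_fiber h) fun _ _ => hh.integrableOn

theorem sum_norm_setIntegral_fiber_le (s : Finset (G ⧸ K)) {h : G → ℂ} (hh : Integrable h μ) :
    ∑ y ∈ s, ‖∫ t in fiber y, h t ∂μ‖ ≤ ∫ t, ‖h t‖ ∂μ := by
  calc ∑ y ∈ s, ‖∫ t in fiber y, h t ∂μ‖ ≤ ∑ y ∈ s, ∫ t in fiber y, ‖h t‖ ∂μ :=
        Finset.sum_le_sum fun y _ => norm_integral_le_integral_norm _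
    _ = ∫ t in ⋃ y ∈ s, fiber y, ‖h t‖ ∂μ :=
        (integral_biUnion_finset s (fun y _ => measurableSet_fiber hKo y)
          (fun _ _ _ _ h => pairwise_disjoint_fiber h) fun _ _ => hh.norm.integrableOn).symm
    _ ≤ ∫ t, ‖h t‖ ∂μ :=
        setIntegral_le_integral hh.norm (Eventually.of_forall fun _ => norm_nonneg _)

/-- The integrals of an integrable function over the left cosets of `K`, as an element of
`ℓ¹(G ⧸ K)`. -/
def cosetIntegral {h : G → ℂ} (hh : Integrable h μ) : lp (fun _ : G ⧸ K => ℂ) 1 :=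
  ⟨fun y => ∫ t in fiber y, h t ∂μ, memℓp_gen' (C := ∫ t, ‖h t‖ ∂μ) fun s => by
    simpa using sum_norm_setIntegral_fiber_le hKo s hh⟩

theorem cosetIntegral_apply {h : G → ℂ} (hh : Integrable h μ) (y : G ⧸ K) :
    cosetIntegral hKo hh y = ∫ t in fiber y, h t ∂μ := rfl

theorem norm_cosetIntegral_le {h : G → ℂ} (hh : Integrable h μ) :
    ‖cosetIntegral hKo hh‖ ≤ ∫ t, ‖h t‖ ∂μ := by
  refine lp.norm_le_of_forall_sum_le (by simp) (integral_nonneg fun _ => norm_nonneg _) fun s => ?_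
  simpa [cosetIntegral_apply] using sum_norm_setIntegral_fiber_le hKo s hh

end Cosets

/-! ### The graph on `G ⧸ K` and transfer of the resolvent -/

section CosetGraph

variable {G : Type*} [Group G] {K : Subgroup G} {D : Set G}

theorem out_inv_mul_out_mem_iff (hDl : ∀ k ∈ K, ∀ d ∈ D, k * d ∈ D)
    (hDr : ∀ d ∈ D, ∀ k ∈ K, d * k ∈ D) (a b : G) :
    (a : G ⧸ K).out⁻¹ * (b : G ⧸ K).out ∈ D ↔ a⁻¹ * b ∈ D := by
  obtain ⟨k, hk⟩ := QuotientGroup.mk_out_eq_mul K a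
  obtain ⟨l, hl⟩ := QuotientGroup.mk_out_eq_mul K b
  rw [hk, hl]
  have h1 : (a * k)⁻¹ * (b * l) = (k : G)⁻¹ * (a⁻¹ * b) * l := by group
  rw [h1]
  constructor
  · intro h
    have h2 := hDl k k.2 _ (hDr _ h l⁻¹ (K.inv_mem l.2))
    simpa [mul_assoc] using h2
  · exact fun h => hDr _ (hDl _ (K.inv_mem k.2) _ h) _ l.2

variable [TopologicalSpace G] [IsTopologicalGroup G] [MeasurableSpace G] [BorelSpace G]
  {μ : Measure G} [μ.IsHaarMeasure] (hKo : IsOpen (K : Set G))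
  (hμK : μ (K : Set G) = 1) (hDl : ∀ k ∈ K, ∀ d ∈ D, k * d ∈ D)
  (hDr : ∀ d ∈ D, ∀ k ∈ K, d * k ∈ D) (hDμ : μ D ≠ ∞)

include hKo hμK hDl hDr hDμ

/-- The neighbouring cosets are disjoint sets of measure `1` inside a translate of `D`, which has
finite measure. -/
theorem finite_cosetNeighbors (x : G ⧸ K) : {y : G ⧸ K | x.out⁻¹ * y.out ∈ D}.Finite := by
  obtain ⟨a, rfl⟩ := QuotientGroup.mk_surjective x
  set S : Set (G ⧸ K) := {y | (a : G ⧸ K).out⁻¹ * y.out ∈ D} with hS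
  have hsub : ∀ y ∈ S, fiber y ⊆ (fun t => a⁻¹ * t) ⁻¹' D := by
    intro y hy t ht
    rw [mem_fiber] at ht
    rw [hS, ← ht, Set.mem_ofPred_eq, out_inv_mul_out_mem_iff hDl hDr] at hy
    exact hy
  have hU : ⋃ y : S, fiber (y : G ⧸ K) ⊆ (fun t => a⁻¹ * t) ⁻¹' D :=
    Set.iUnion_subset fun y => hsub y y.2
  have hfin := finite_const_le_meas_of_disjoint_iUnion μ (ε := 1) one_pos
    (As := fun y : S => fiber (y : G ⧸ K)) (fun y => measurableSet_fiber hKo _)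
    (fun y z hyz => pairwise_disjoint_fiber fun h => hyz (Subtype.ext h)) (by
      refine ((measure_mono hU).trans_lt ?_).ne
      rw [measure_preimage_mul]
      exact hDμ.lt_top)
  have huniv : {y : S | 1 ≤ μ (fiber (y : G ⧸ K))} = Set.univ := by
    ext y
    simp [measure_fiber hμK]
  rw [huniv, Set.finite_univ_iff] at hfin
  exact Set.toFinite S

/-- The neighbours of a coset `x K` in the graph on `G ⧸ K` defined by the biinvariant set `D`:
the cosets contained in `x D`. -/
def cosetNeighbors (x : G ⧸ K) : Finset (G ⧸ K) :=
  (finite_cosetNeighbors hKo hμK hDl hDr hDμ x).toFinset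

theorem mk_mem_cosetNeighbors (a b : G) :
    (b : G ⧸ K) ∈ cosetNeighbors hKo hμK hDl hDr hDμ (a : G ⧸ K) ↔ a⁻¹ * b ∈ D := by
  rw [cosetNeighbors, Set.Finite.mem_toFinset, Set.mem_ofPred_eq,
    out_inv_mul_out_mem_iff hDl hDr]

theorem biUnion_fiber_cosetNeighbors (a : G) :
    ⋃ y ∈ cosetNeighbors hKo hμK hDl hDr hDμ (a : G ⧸ K), fiber y =
      (fun t => a⁻¹ * t) ⁻¹' D := by
  ext t
  simp only [Set.mem_iUnion, mem_fiber, exists_prop, Set.mem_preimage]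
  rw [← mk_mem_cosetNeighbors hKo hμK hDl hDr hDμ]
  simp

theorem card_cosetNeighbors (x : G ⧸ K) :
    ((cosetNeighbors hKo hμK hDl hDr hDμ x).card : ℝ≥0∞) = μ D := by
  obtain ⟨a, rfl⟩ := QuotientGroup.mk_surjective x
  rw [← measure_biUnion_fiber hKo hμK, biUnion_fiber_cosetNeighbors, measure_preimage_mul]

theorem cosetNeighbors_symm (hDinv : ∀ d ∈ D, d⁻¹ ∈ D) (x y : G ⧸ K)
    (h : y ∈ cosetNeighbors hKo hμK hDl hDr hDμ x) :
    x ∈ cosetNeighbors hKo hμK hDl hDr hDμ y := by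
  obtain ⟨a, rfl⟩ := QuotientGroup.mk_surjective x
  obtain ⟨b, rfl⟩ := QuotientGroup.mk_surjective y
  rw [mk_mem_cosetNeighbors] at h ⊢
  simpa using hDinv _ h

theorem measure_pow_le_card_walkEnds [DecidableEq (G ⧸ K)] (n : ℕ) :
    μ (D ^ n) ≤
      (walkEnds (cosetNeighbors hKo hμK hDl hDr hDμ) ((1 : G) : G ⧸ K) n).card := by
  rw [← measure_biUnion_fiber hKo hμK]
  refine measure_mono ?_
  suffices ∀ t ∈ D ^ n,
      (t : G ⧸ K) ∈ walkEnds (cosetNeighbors hKo hμK hDl hDr hDμ) ((1 : G) : G ⧸ K) n by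
    intro t ht
    simpa using this t ht
  induction n with
  | zero =>
    intro t ht
    rw [pow_zero, Set.mem_one] at ht
    rw [ht]
    exact Finset.mem_singleton_self _
  | succ n ih =>
    intro t ht
    rw [pow_succ] at ht
    obtain ⟨a, ha, d, hd, rfl⟩ := Set.mem_mul.1 ht
    refine Finset.mem_biUnion.2 ⟨_, ih a ha, ?_⟩
    rw [mk_mem_cosetNeighbors]
    simpa using hd

omit hKo hμK hDl hDr hDμ in
theorem l1Conv_translate (h f : G → ℂ) (a t : G) :
    l1Conv μ h f (a⁻¹ * t) = l1Conv μ (fun s => h (a⁻¹ * s)) f t := by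
  rw [l1Conv, l1Conv, ← integral_mul_left_eq_self _ a⁻¹]
  congr 1
  ext y
  congr 2
  group

/-- As `D = D⁻¹`, the convolution at `t` integrates `h` over `tD`, a disjoint union of left cosets.
-/
theorem l1Conv_indicator (hD : MeasurableSet D) (hDinv : ∀ d ∈ D, d⁻¹ ∈ D) {h : G → ℂ}
    (hh : Integrable h μ) (t : G) :
    l1Conv μ h (D.indicator 1) t =
      ∑ y ∈ cosetNeighbors hKo hμK hDl hDr hDμ (t : G ⧸ K), cosetIntegral hKo hh y := by
  simp only [cosetIntegral_apply]
  rw [← setIntegral_biUnion_fiber hKo _ hh, biUnion_fiber_cosetNeighbors,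
    ← integral_indicator (hD.preimage (measurable_const_mul t⁻¹)), l1Conv]
  congr 1
  ext y
  have hiff : y⁻¹ * t ∈ D ↔ y ∈ (fun s => t⁻¹ * s) ⁻¹' D :=
    ⟨fun h => by simpa using hDinv _ h, fun h => by simpa using hDinv _ h⟩
  by_cases hy : y⁻¹ * t ∈ D
  · rw [Set.indicator_of_mem hy, Set.indicator_of_mem (hiff.1 hy)]
    simp
  · rw [Set.indicator_of_notMem hy, Set.indicator_of_notMem (mt hiff.2 hy), mul_zero]

/-- After translation by `a`, the resolvent equation equates `z h(a⁻¹t)` almost everywhere with a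
function constant on left cosets; integrating over one coset, of mass `1`, gives the equation on `G
⧸ K`. -/
theorem resolvent_cosetIntegral [DecidableEq (G ⧸ K)] (hD : MeasurableSet D)
    (hDinv : ∀ d ∈ D, d⁻¹ ∈ D)
    {h : G → ℂ} {z c : ℂ} (a : G) (ha : Integrable (fun t => h (a⁻¹ * t)) μ)
    (hres : ∀ᵐ t ∂μ, z * h t - c * D.indicator 1 t - l1Conv μ h (D.indicator 1) t = 0)
    (w : G ⧸ K) :
    z * cosetIntegral hKo ha w =
      (if (a : G ⧸ K) ∈ cosetNeighbors hKo hμK hDl hDr hDμ w then c else 0) +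
      ∑ y ∈ cosetNeighbors hKo hμK hDl hDr hDμ w, cosetIntegral hKo ha y := by
  have h1 : ∀ᵐ t ∂μ, z * h (a⁻¹ * t) - c * D.indicator 1 (a⁻¹ * t) -
      l1Conv μ h (D.indicator 1) (a⁻¹ * t) = 0 :=
    (measurePreserving_mul_left μ a⁻¹).quasiMeasurePreserving.ae hres
  have h2 : ∀ᵐ t ∂μ, t ∈ fiber w → z * h (a⁻¹ * t) =
      (if (a : G ⧸ K) ∈ cosetNeighbors hKo hμK hDl hDr hDμ w then c else 0) +
      ∑ y ∈ cosetNeighbors hKo hμK hDl hDr hDμ w, cosetIntegral hKo ha y := by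
    filter_upwards [h1] with t ht htw
    rw [mem_fiber] at htw
    subst htw
    rw [l1Conv_translate, l1Conv_indicator hKo hμK hDl hDr hDμ hD hDinv ha, sub_sub,
      sub_eq_zero] at ht
    rw [ht]
    congr 1
    have hiff : (a : G ⧸ K) ∈ cosetNeighbors hKo hμK hDl hDr hDμ (t : G ⧸ K) ↔ a⁻¹ * t ∈ D := by
      rw [mk_mem_cosetNeighbors]
      exact ⟨fun h => by simpa using hDinv _ h, fun h => by simpa using hDinv _ h⟩
    by_cases hat : a⁻¹ * t ∈ D
    · rw [if_pos (hiff.2 hat), Set.indicator_of_mem hat]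
      simp
    · rw [if_neg (mt hiff.1 hat), Set.indicator_of_notMem hat, mul_zero]
  have h3 := setIntegral_congr_ae (measurableSet_fiber hKo w) h2
  rw [integral_const_mul, setIntegral_const] at h3
  rw [cosetIntegral_apply, h3, measureReal_def, measure_fiber hμK]
  simp

theorem im_eq_zero_of_mem_spectrum_cosetAdjacency [DecidableEq (G ⧸ K)] (hD : MeasurableSet D)
    (hDinv : ∀ d ∈ D, d⁻¹ ∈ D) {m : ℕ}
    (hN : ∀ x, (cosetNeighbors hKo hμK hDl hDr hDμ x).card ≤ m)
    (hreal : ∀ z ∈ l1Spectrum μ (D.indicator 1), z.im = 0) :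
    ∀ z ∈ spectrum ℂ (adjacency (cosetNeighbors hKo hμK hDl hDr hDμ) m hN), z.im = 0 := by
  intro z hz
  by_contra hne
  have hsymm := cosetNeighbors_symm hKo hμK hDl hDr hDμ hDinv
  have hz' : z ∉ l1Spectrum μ (D.indicator 1) := fun h => hne (hreal z h)
  rw [l1Spectrum, Set.mem_ofPred_eq, not_not] at hz'
  obtain ⟨c, h, hh, hzc, -, hres⟩ := hz'
  refine notMem_spectrum_adjacency hN hsymm (C := ‖c‖ + ∫ t, ‖h t‖ ∂μ) (fun x => ?_) hz
  have ha : Integrable (fun t => h (x.out⁻¹ * t)) μ := hh.comp_mul_left x.out⁻¹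
  -- The column at `x` is the image of `c 1 + h` translated to `x`; its norm bound is independent of
  -- `x` by left invariance.
  refine ⟨c • lp.single 1 x 1 + cosetIntegral hKo ha, ?_, ?_⟩
  · refine (norm_add_le _ _).trans (add_le_add ?_ ?_)
    · rw [norm_smul, lp.norm_single one_pos, norm_one, mul_one]
    · refine (norm_cosetIntegral_le hKo ha).trans_eq ?_
      exact integral_mul_left_eq_self (fun t => ‖h t‖) x.out⁻¹
  · ext w
    have hI := resolvent_cosetIntegral hKo hμK hDl hDr hDμ hD hDinv x.out ha hres w
    rw [QuotientGroup.out_eq'] at hI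
    have hT := adjacency_apply hN hsymm (c • lp.single 1 x 1 + cosetIntegral hKo ha) w
    rw [lp.coeFn_sub, Pi.sub_apply, hT]
    simp only [lp.coeFn_smul, lp.coeFn_add, Pi.smul_apply, Pi.add_apply, smul_eq_mul,
      lp.single_apply, Pi.single_apply, Finset.sum_add_distrib, mul_add, mul_ite, mul_one,
      mul_zero, Finset.sum_ite_eq', hI, hzc]
    ring

end CosetGraph

/-! ### Triviality of the modular function on `KgK` -/

section Modular

variable {G : Type*} [Group G] [TopologicalSpace G] [IsTopologicalGroup G]
  [LocallyCompactSpace G]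

theorem modularFunction_mul (x y : G) :
    modularFunction (x * y) = modularFunction x * modularFunction y := by
  simp only [modularFunction, _root_.map_mul, mul_inv]

theorem modularFunction_eq_one_of_mem [MeasurableSpace G] [BorelSpace G] (μ : Measure G)
    [μ.IsHaarMeasure] [μ.Regular] {K : Subgroup G} (hμK : μ (K : Set G) = 1) {k : G}
    (hk : k ∈ K) : modularFunction k = 1 := by
  have h := measure_mul_singleton μ k (K : Set G)
  rw [Subgroup.subgroup_mul_singleton hk, hμK, mul_one] at h
  exact_mod_cast h.symm

/-- `Δ` is trivial on `K`, hence constant on `KgK`; as `g⁻¹ ∈ KgK`, this gives `Δ(g)² = 1`, and `Δ`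
is nonnegative. -/
theorem modularFunction_eq_one_of_mem_doubleCoset [MeasurableSpace G] [BorelSpace G]
    (μ : Measure G) [μ.IsHaarMeasure] [μ.Regular] {K : Subgroup G} (hμK : μ (K : Set G) = 1)
    {g x : G} (hg : g⁻¹ ∈ DoubleCoset.doubleCoset g (K : Set G) (K : Set G))
    (hx : x ∈ DoubleCoset.doubleCoset g (K : Set G) (K : Set G)) : modularFunction x = 1 := by
  have key : ∀ y ∈ DoubleCoset.doubleCoset g (K : Set G) (K : Set G),
      modularFunction y = modularFunction g := by
    intro y hy
    obtain ⟨k, hk, l, hl, rfl⟩ := DoubleCoset.mem_doubleCoset.1 hy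
    rw [modularFunction_mul, modularFunction_mul, modularFunction_eq_one_of_mem μ hμK hk,
      modularFunction_eq_one_of_mem μ hμK hl, one_mul, mul_one]
  rw [key x hx]
  have h0 : modularFunction g * modularFunction g⁻¹ = 1 := by
    rw [← modularFunction_mul, mul_inv_cancel]
    exact modularFunction_eq_one_of_mem μ hμK K.one_mem
  rw [key _ hg] at h0
  exact (pow_eq_one_iff_of_nonneg zero_le two_ne_zero).1 ((pow_two _).trans h0)

end Modular

end LCGroup

end

theorem mainTheorem3 {G : Type*} [Group G] [TopologicalSpace G] [IsTopologicalGroup G]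
    [LocallyCompactSpace G] [T2Space G] [MeasurableSpace G] [BorelSpace G]
    (μ : Measure G) [μ.IsHaarMeasure] [μ.Regular]
    (K : Subgroup G) (hKc : IsCompact (K : Set G)) (hKo : IsOpen (K : Set G))
    (hμK : μ (K : Set G) = 1)
    (hg : ∃ g : G,
      DoubleCoset.doubleCoset g (K : Set G) (K : Set G) =
        DoubleCoset.doubleCoset g⁻¹ (K : Set G) (K : Set G) ∧
      1 < μ (DoubleCoset.doubleCoset g (K : Set G) (K : Set G)) ∧
      μ (DoubleCoset.doubleCoset g (K : Set G) (K : Set G)) / 2 <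
        LCGroup.growthRate μ (DoubleCoset.doubleCoset g (K : Set G) (K : Set G))) :
    ¬ LCGroup.IsHermitian μ := by
  classical
  intro hH
  obtain ⟨g, hginv, hone, hgrowth⟩ := hg
  have hginv' : g⁻¹ ∈ DoubleCoset.doubleCoset g (K : Set G) (K : Set G) := by
    rw [hginv]
    exact DoubleCoset.mem_doubleCoset_self K K g⁻¹
  have hmod := fun x => LCGroup.modularFunction_eq_one_of_mem_doubleCoset μ hμK (x := x) hginv'
  have hDc : IsCompact (DoubleCoset.doubleCoset g (K : Set G) (K : Set G)) :=
    (hKc.mul isCompact_singleton).mul hKc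
  have hDo : IsOpen (DoubleCoset.doubleCoset g (K : Set G) (K : Set G)) := hKo.mul_left
  have hDl : ∀ k ∈ K, ∀ d ∈ DoubleCoset.doubleCoset g (K : Set G) (K : Set G),
      k * d ∈ DoubleCoset.doubleCoset g (K : Set G) (K : Set G) := by
    intro k hk d hd
    obtain ⟨a, ha, b, hb, rfl⟩ := DoubleCoset.mem_doubleCoset.1 hd
    exact DoubleCoset.mem_doubleCoset.2 ⟨k * a, K.mul_mem hk ha, b, hb, by group⟩
  have hDr : ∀ d ∈ DoubleCoset.doubleCoset g (K : Set G) (K : Set G), ∀ k ∈ K,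
      d * k ∈ DoubleCoset.doubleCoset g (K : Set G) (K : Set G) := by
    intro d hd k hk
    obtain ⟨a, ha, b, hb, rfl⟩ := DoubleCoset.mem_doubleCoset.1 hd
    exact DoubleCoset.mem_doubleCoset.2 ⟨a, ha, b * k, K.mul_mem hb hk, by group⟩
  have hDinv : ∀ d ∈ DoubleCoset.doubleCoset g (K : Set G) (K : Set G),
      d⁻¹ ∈ DoubleCoset.doubleCoset g (K : Set G) (K : Set G) := by
    intro d hd
    obtain ⟨a, ha, b, hb, rfl⟩ := DoubleCoset.mem_doubleCoset.1 hd
    rw [hginv]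
    exact DoubleCoset.mem_doubleCoset.2 ⟨b⁻¹, K.inv_mem hb, a⁻¹, K.inv_mem ha, by group⟩
  generalize DoubleCoset.doubleCoset g (K : Set G) (K : Set G) = D at *
  have hDμ : μ D ≠ ∞ := hDc.measure_lt_top.ne
  have hreal := hH (D.indicator 1)
    ((integrable_indicator_iff hDo.measurableSet).2 (integrableOn_const hDμ)) (by
      refine Eventually.of_forall fun x => ?_
      by_cases hx : x⁻¹ ∈ D
      · have hx' : x ∈ D := by simpa using hDinv _ hx
        simp [LCGroup.involution, hx, hx', hmod _ hx]
      · have hx' : x ∉ D := fun h => hx (hDinv _ h)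
        simp [LCGroup.involution, hx, hx'])
  set m := (LCGroup.cosetNeighbors hKo hμK hDl hDr hDμ ((1 : G) : G ⧸ K)).card with hm
  have hμD : μ D = m := (LCGroup.card_cosetNeighbors hKo hμK hDl hDr hDμ _).symm
  have hN : ∀ x, (LCGroup.cosetNeighbors hKo hμK hDl hDr hDμ x).card ≤ m := fun x => by
    have := LCGroup.card_cosetNeighbors hKo hμK hDl hDr hDμ x
    rw [hμD] at this
    exact (Nat.cast_injective this).le
  -- `μ(D)` is the integer `m`, so `μ(D) > 1` gives `m / 2 ≥ 1`, and hence `c > 1` below.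
  have hm2 : 2 ≤ m := by
    rw [hμD] at hone
    exact_mod_cast hone
  have hm2' : (2 : ℝ) ≤ m := by exact_mod_cast hm2
  obtain ⟨d, hd1, hd2⟩ := ENNReal.lt_iff_exists_nnreal_btwn.1 hgrowth
  have hmd : (m : ℝ) / 2 < d := by
    rw [hμD] at hd1
    have h2 : ((m : ℝ≥0∞) / 2) = (((m : ℝ≥0) / 2 : ℝ≥0) : ℝ≥0∞) := by
      rw [ENNReal.coe_div two_ne_zero]
      simp
    rw [h2, ENNReal.coe_lt_coe] at hd1
    exact_mod_cast hd1
  -- The gap between `c` and `d` absorbs the factor `n + 1` from summing spheres.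
  obtain ⟨c, hc1, hc2⟩ := exists_between hmd
  obtain ⟨C, hC, hcard⟩ := LCGroup.card_walkEnds_le hN
    (LCGroup.cosetNeighbors_symm hKo hμK hDl hDr hDμ hDinv) (by omega)
    (LCGroup.im_eq_zero_of_mem_spectrum_cosetAdjacency hKo hμK hDl hDr hDμ hDo.measurableSet
      hDinv hN hreal) ((1 : G) : G ⧸ K) (c := c) (by linarith) hc1
  have hle := LCGroup.limsup_rpow_one_div_le (s := fun n => μ (D ^ n)) (by linarith) hc2
    fun n => by
      refine (LCGroup.measure_pow_le_card_walkEnds hKo hμK hDl hDr hDμ n).trans ?_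
      rw [← ENNReal.ofReal_natCast]
      exact ENNReal.ofReal_le_ofReal (hcard n)
  rw [ENNReal.ofReal_coe_nnreal] at hle
  exact absurd hd2 (not_lt.2 hle)
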